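/- Let $(X,\mathcal B,m)$ be a measure space whose measure $m$ is localizable, i.e. every measurable $A$ with $m(A)=\infty$ contains a measurable $A'$ with $0<m(A')<\infty$, and every family $\mathcal A\subseteq\mathcal B$ has an essential supremum: a set $S\in\mathcal B$ with $m(A\setminus S)=0$ for all $A\in\mathcal A$ and such that $m(S\setminus G)=0$ for every $G\in\mathcal B$ with $m(A\setminus G)=0$ for all $A\in\mathcal A$. Let $L^0(m)$ be the space of $m$-a.e. classes of measurable functions $X\to\mathbb R$, and let $\tau(m)$ be the topology of local convergence in measure, generated by the pseudometrics $d_U(f,g)=\int_U |f-g|\wedge 1\,dm$ for $U\in\mathcal B$ with $m(U)<\infty$. An energy form is a functional $E\colon L^0(m)\to[0,\infty]$ such that * $2E(f)+2E(g)=E(f-g)+E(f+g)$ and $E(\lambda f)=|\lambda|^2E(f)$ for all $f,g\in L^0(m)$, $\lambda\in\mathbb R$ (with $0\cdot\infty=0$); * (Markov property) for each $\varepsilon>0$ there is a monotone increasing function $C_\varepsilon\colon\mathbb R\to[-\varepsilon,1+\varepsilon]$ with $|C_\varepsilon(x)-C_\varepsilon(y)|\le|x-y|$ for all $x,y\in\mathbb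 R$ and $C_\varepsilon(x)=x$ for $x\in[0,1]$, such that $E(C_\varepsilon\circ f)\le E(f)$ for all $f\in L^0(m)$; * (closedness) the domain $D(E)=\{f\in L^0(m): E(f)<\infty\}$ is complete with respect to the form topology, the coarsest topology containing both the subspace topology of $\tau(m)$ and the topology of the seminorm $\|f\|_E=E(f)^{1/2}$ (completeness refers to the translation invariant uniform structure of this vector space topology). On $D(E)$ write $E(f,g)=\frac14\bigl(E(f+g)-E(f-g)\bigr)$. **Theorem.** Let $E$ be an energy form on $L^0(m)$. The following assertions are equivalent. 1. $E$ is transient, i.e. $\ker E=\{f\in L^0(m): E(f)=0\}=\{0\}$. 2. The embedding $(D(E),\|\cdot\|_E)\to(L^0(m),\tau(m))$, $f\mapsto f$, is continuous. 3. $(D(E),E)$ is a Hilbert space, i.e. the bilinear form $E(\cdot,\cdot)$ is a (positive definite) inner product on $D(E)$ for which $D(E)$ is complete. -/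

import Mathlib

open MeasureTheory Set
open scoped ENNReal

noncomputable section

namespace EnergyForm

/-! ### Quadratic forms with values in `[0,∞]` -/

/-- A (positive) quadratic form on a real vector space: a functional `q : V → [0,∞]` that satisfies
the parallelogram identity and is homogeneous of degree two (with `0 * ∞ = 0`). -/
structure QuadForm (V : Type*) [AddCommGroup V] [Module ℝ V] where
  toFun : V → ℝ≥0∞
  parallelogram : ∀ u v : V, 2 * toFun u + 2 * toFun v = toFun (u - v) + toFun (u + v)
  homogeneous : ∀ (c : ℝ) (u : V), toFun (c • u) = ENNReal.ofReal (|c| ^ 2) * toFun u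

namespace QuadForm

variable {V : Type*} [AddCommGroup V] [Module ℝ V]

instance : CoeFun (QuadForm V) (fun _ => V → ℝ≥0∞) := ⟨QuadForm.toFun⟩

theorem map_zero (q : QuadForm V) : q 0 = 0 := by
  simpa using q.homogeneous 0 0

/-- The domain `D(q) = {u | q u < ∞}`, a linear subspace of `V`. -/
def domain (q : QuadForm V) : Submodule ℝ V where
  carrier := {u | q u < ∞}
  zero_mem' := by simp [q.map_zero]
  add_mem' := by
    intro u v hu hv
    have hu' : q u < ∞ := hu
    have hv' : q v < ∞ := hv
    have h : 2 * q u + 2 * q v < ∞ :=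
      ENNReal.add_lt_top.2 ⟨ENNReal.mul_lt_top (by simp) hu', ENNReal.mul_lt_top (by simp) hv'⟩
    rw [q.parallelogram u v] at h
    exact (ENNReal.add_lt_top.1 h).2
  smul_mem' := by
    intro c u hu
    have hu' : q u < ∞ := hu
    change q (c • u) < ∞
    rw [q.homogeneous]
    exact ENNReal.mul_lt_top ENNReal.ofReal_lt_top hu'

/-- The kernel `ker q = {u | q u = 0}`. -/
def ker (q : QuadForm V) : Set V := {u | q u = 0}

/-- The (finite) value of `q` at an element of its domain, as a real number. -/
def val (q : QuadForm V) (u : q.domain) : ℝ := (q (u : V)).toReal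

/-- Polarization: `q(u,v) = (q(u+v) - q(u-v)) / 4` for `u, v ∈ D(q)`. -/
def polar (q : QuadForm V) (u v : q.domain) : ℝ := (1 / 4) * (q.val (u + v) - q.val (u - v))

theorem val_nonneg (q : QuadForm V) (u : q.domain) : 0 ≤ q.val u := ENNReal.toReal_nonneg

theorem val_parallelogram (q : QuadForm V) (u v : q.domain) :
    2 * q.val u + 2 * q.val v = q.val (u - v) + q.val (u + v) := by
  have fin : ∀ w : q.domain, q (w : V) ≠ ∞ := fun w => ne_of_lt w.2
  have h := congrArg ENNReal.toReal (q.parallelogram (u : V) (v : V))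
  have h1 := fin (u - v)
  have h2 := fin (u + v)
  rw [Submodule.coe_sub] at h1
  rw [Submodule.coe_add] at h2
  rw [ENNReal.toReal_add (ENNReal.mul_ne_top (by simp) (fin u))
    (ENNReal.mul_ne_top (by simp) (fin v)), ENNReal.toReal_add h1 h2] at h
  simpa [val] using h

theorem val_smul (q : QuadForm V) (c : ℝ) (u : q.domain) : q.val (c • u) = c ^ 2 * q.val u := by
  simp [val, q.homogeneous, sq_nonneg]

theorem val_zero (q : QuadForm V) : q.val 0 = 0 := by simp [val, q.map_zero]

theorem val_neg (q : QuadForm V) (u : q.domain) : q.val (-u) = q.val u := by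
  simpa using q.val_smul (-1) u

theorem polar_self (q : QuadForm V) (u : q.domain) : q.polar u u = q.val u := by
  have h : u + u = (2 : ℝ) • u := (two_smul ℝ u).symm
  rw [polar, sub_self, q.val_zero, h, q.val_smul]
  ring

theorem polar_comm (q : QuadForm V) (u v : q.domain) : q.polar u v = q.polar v u := by
  rw [polar, polar, add_comm u v, ← neg_sub v u, q.val_neg]

theorem polar_add_left (q : QuadForm V) (u w v : q.domain) :
    q.polar (u + w) v = q.polar u v + q.polar w v := by
  have h1 := q.val_parallelogram (u + v) w
  have h2 := q.val_parallelogram (w + v) u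
  have h3 := q.val_parallelogram (u - v) w
  have h4 := q.val_parallelogram (w - v) u
  have e1 : q.val (u - v - w) = q.val (w + v - u) := by
    rw [← q.val_neg]; congr 1; abel
  have e2 : q.val (w - v - u) = q.val (u + v - w) := by
    rw [← q.val_neg]; congr 1; abel
  have e3 : u + v + w = u + w + v := by abel
  have e4 : w + v + u = u + w + v := by abel
  have e5 : u - v + w = u + w - v := by abel
  have e6 : w - v + u = u + w - v := by abel
  rw [e3] at h1
  rw [e4] at h2
  rw [e5, e1] at h3
  rw [e6, e2] at h4
  simp only [polar]
  linarith

theorem polar_smul_left (q : QuadForm V) (c : ℝ) (u v : q.domain) :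
    q.polar (c • u) v = c * q.polar u v := by
  let f : ℝ →+ ℝ :=
    { toFun := fun t => q.polar (t • u) v
      map_zero' := by simp [polar, q.val_neg]
      map_add' := fun s t => by rw [add_smul, q.polar_add_left] }
  have hf : Continuous f := by
    refine f.continuous_of_isBounded_nhds_zero (Metric.closedBall_mem_nhds (0 : ℝ) one_pos) ?_
    refine (Metric.isBounded_closedBall (x := (0 : ℝ)) (r := q.val u + q.val v)).subset ?_
    rintro _ ⟨t, ht, rfl⟩
    rw [Metric.mem_closedBall, dist_zero_right, Real.norm_eq_abs] at ht ⊢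
    have ht' : t ^ 2 ≤ 1 := by nlinarith [abs_le.1 ht, sq_abs t, abs_nonneg t]
    have h := q.val_parallelogram (t • u) v
    rw [q.val_smul] at h
    have h1 := q.val_nonneg (t • u + v)
    have h2 := q.val_nonneg (t • u - v)
    have h3 := q.val_nonneg u
    have h4 := q.val_nonneg v
    have h5 : t ^ 2 * q.val u ≤ 1 * q.val u := mul_le_mul_of_nonneg_right ht' h3
    change |q.polar (t • u) v| ≤ _
    rw [polar, abs_le]
    constructor <;> linarith
  have h := map_real_smul f hf c 1
  simpa [f] using h

/-- The form seen as a positive semidefinite inner product on its domain. -/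
@[reducible]
def preInner (q : QuadForm V) : PreInnerProductSpace.Core ℝ q.domain where
  inner u v := q.polar u v
  conj_inner_symm u v := by simpa using q.polar_comm v u
  re_inner_nonneg u := by simpa [q.polar_self u] using q.val_nonneg u
  add_left u w v := q.polar_add_left u w v
  smul_left u v c := by simpa using q.polar_smul_left c u v

/-- The form seminorm `‖u‖_q = √(q u)` on the domain of `q`. -/
def formSeminorm (q : QuadForm V) : Seminorm ℝ q.domain :=
  Seminorm.of (fun u => Real.sqrt (q.val u))
    (fun u v => by
      let := InnerProductSpace.Core.toSeminormedAddCommGroup (c := q.preInner)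
      have key : ∀ w : q.domain, ‖w‖ = Real.sqrt (q.val w) := fun w => by
        rw [← q.polar_self w]; rfl
      rw [← key, ← key, ← key]
      exact norm_add_le u v)
    (fun c u => by
      rw [q.val_smul, Real.sqrt_mul (sq_nonneg c), Real.sqrt_sq_eq_abs, Real.norm_eq_abs])

/-- The uniform structure on `D(q)` given by the pseudometric `‖u - v‖_q`. -/
abbrev seminormUniformSpace (q : QuadForm V) : UniformSpace q.domain :=
  q.formSeminorm.toSeminormedAddCommGroup.toUniformSpace

/-- The canonical uniform structure of `(D(q), τ_q)`, where the form topology `τ_q` is the coarsest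
topology containing the subspace topology and the topology of `‖·‖_q`; here `𝓤` is the
(translation invariant) uniform structure of `V`. -/
abbrev formUniformSpace (𝓤 : UniformSpace V) (q : QuadForm V) : UniformSpace q.domain :=
  UniformSpace.comap (Subtype.val : q.domain → V) 𝓤 ⊓ q.seminormUniformSpace

/-- `q` is closed if `(D(q), τ_q)` is complete. -/
def IsClosed (𝓤 : UniformSpace V) (q : QuadForm V) : Prop :=
  @CompleteSpace q.domain (q.formUniformSpace 𝓤)

/-- `(D(q), q)` is a Hilbert space: the polarization of `q` is a (positive definite) inner product
on `D(q)`, and `D(q)` is complete in the norm that it induces. -/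
def IsHilbert (q : QuadForm V) : Prop :=
  ∃ c : InnerProductSpace.Core ℝ q.domain, (∀ u v : q.domain, c.inner u v = q.polar u v) ∧
    @CompleteSpace q.domain
      (InnerProductSpace.Core.toNormedAddCommGroup (cd := c)).toUniformSpace

end QuadForm

/-! ### The space `L⁰(m)` with local convergence in measure -/

section LZero

variable {X : Type*} [MeasurableSpace X]

/-- The measurable sets of finite measure. -/
abbrev FinSets (m : Measure X) : Type _ := {U : Set X // MeasurableSet U ∧ m U < ∞}

theorem integrable_dist (m : Measure X) (U : FinSets m) (f g : X →ₘ[m] ℝ) :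
    Integrable (fun x => min |f x - g x| 1) (m.restrict U.1) := by
  have : IsFiniteMeasure (m.restrict U.1) := ⟨by simpa using U.2.2⟩
  have hm : AEStronglyMeasurable (fun x => min |f x - g x| 1) (m.restrict U.1) :=
    (((f.aestronglyMeasurable.sub g.aestronglyMeasurable).norm).inf
      aestronglyMeasurable_const).restrict
  refine Integrable.of_bound hm 1 (Filter.Eventually.of_forall fun x => ?_)
  rw [Real.norm_eq_abs, abs_of_nonneg (le_min (abs_nonneg _) zero_le_one)]
  exact min_le_right _ _

/-- The pseudometric `d_U(f,g) = ∫_U |f - g| ∧ 1 dm` on `L⁰(m)`, for `U` of finite measure. -/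
abbrev pseudoMetric (m : Measure X) (U : FinSets m) : PseudoMetricSpace (X →ₘ[m] ℝ) where
  dist f g := ∫ x in U.1, min |f x - g x| 1 ∂m
  dist_self f := by simp
  dist_comm f g := by simp only [abs_sub_comm]
  dist_triangle f g h := by
    rw [← integral_add (integrable_dist m U f g) (integrable_dist m U g h)]
    refine integral_mono (integrable_dist m U f h)
      ((integrable_dist m U f g).add (integrable_dist m U g h)) fun x => ?_
    have h1 := abs_sub_le (f x) (g x) (h x)
    have h2 := abs_nonneg (f x - g x)
    have h3 := abs_nonneg (g x - h x)
    change min |f x - h x| 1 ≤ min |f x - g x| 1 + min |g x - h x| 1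
    rcases min_cases |f x - h x| 1 with a | a <;> rcases min_cases |f x - g x| 1 with b | b <;>
      rcases min_cases |g x - h x| 1 with c | c <;> linarith

/-- The uniform structure of local convergence in measure, generated by all the `d_U`. -/
abbrev localMeasureUniformSpace (m : Measure X) : UniformSpace (X →ₘ[m] ℝ) :=
  ⨅ U : FinSets m, (pseudoMetric m U).toUniformSpace

/-- The uniform structure of local convergence in measure is the canonical (translation invariant)
one of the additive group `L⁰(m)` with the topology of local convergence in measure. -/
theorem isUniformAddGroup_localMeasure (m : Measure X) :
    @IsUniformAddGroup (X →ₘ[m] ℝ) (localMeasureUniformSpace m) _ := by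
  refine isUniformAddGroup_iInf fun U => ?_
  let := pseudoMetric m U
  have key : ∀ f g f' g' : X →ₘ[m] ℝ, dist (f - g) (f' - g') ≤ dist f f' + dist g g' := by
    intro f g f' g'
    change (∫ x in U.1, min |(f - g) x - (f' - g') x| 1 ∂m) ≤
      (∫ x in U.1, min |f x - f' x| 1 ∂m) + ∫ x in U.1, min |g x - g' x| 1 ∂m
    rw [← integral_add (integrable_dist m U f f') (integrable_dist m U g g')]
    refine integral_mono_ae (integrable_dist m U _ _)
      ((integrable_dist m U f f').add (integrable_dist m U g g')) ?_
    filter_upwards [ae_restrict_of_ae (AEEqFun.coeFn_sub f g),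
      ae_restrict_of_ae (AEEqFun.coeFn_sub f' g')] with x hx hx'
    change min |(f - g) x - (f' - g') x| 1 ≤ min |f x - f' x| 1 + min |g x - g' x| 1
    rw [hx, hx', Pi.sub_apply, Pi.sub_apply]
    have h1 : |f x - g x - (f' x - g' x)| ≤ |f x - f' x| + |g x - g' x| := by
      have h0 : f x - g x - (f' x - g' x) = (f x - f' x) + -(g x - g' x) := by ring
      rw [h0, ← abs_neg (g x - g' x)]
      exact abs_add_le _ _
    have h2 := abs_nonneg (f x - f' x)
    have h3 := abs_nonneg (g x - g' x)
    rcases min_cases |f x - g x - (f' x - g' x)| 1 with a | a <;>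
      rcases min_cases |f x - f' x| 1 with b | b <;>
      rcases min_cases |g x - g' x| 1 with c | c <;> linarith
  refine ⟨Metric.uniformContinuous_iff.2 fun ε hε => ⟨ε / 2, half_pos hε, ?_⟩⟩
  rintro ⟨f, g⟩ ⟨f', g'⟩ h
  rw [Prod.dist_eq, max_lt_iff] at h
  have := key f g f' g'
  have h1 : dist f f' < ε / 2 := h.1
  have h2 : dist g g' < ε / 2 := h.2
  change dist (f - g) (f' - g') < ε
  linarith

/-- The topology `τ(m)` of local convergence in measure on `L⁰(m)`. -/
abbrev tau (m : Measure X) : TopologicalSpace (X →ₘ[m] ℝ) :=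
  (localMeasureUniformSpace m).toTopologicalSpace

/-- The measure `m` is localizable: it is semi-finite and every family of measurable sets has an
essential supremum. -/
structure IsLocalizable (m : Measure X) : Prop where
  semifinite : ∀ A : Set X, MeasurableSet A → m A = ∞ →
    ∃ A' : Set X, A' ⊆ A ∧ MeasurableSet A' ∧ 0 < m A' ∧ m A' < ∞
  exists_essSup : ∀ 𝒜 : Set (Set X), (∀ A ∈ 𝒜, MeasurableSet A) →
    ∃ S : Set X, MeasurableSet S ∧ (∀ A ∈ 𝒜, m (A \ S) = 0) ∧
      ∀ G : Set X, MeasurableSet G → (∀ A ∈ 𝒜, m (A \ G) = 0) → m (S \ G) = 0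

/-- An `ε`-cutoff: a monotone increasing normal contraction `ℝ → ℝ` with values in
`[-ε, 1 + ε]` that is the identity on `[0,1]`. -/
structure IsCutoff (ε : ℝ) (C : ℝ → ℝ) : Prop where
  map_zero : C 0 = 0
  contraction : ∀ x y : ℝ, |C x - C y| ≤ |x - y|
  monotone : Monotone C
  mapsTo : ∀ x : ℝ, C x ∈ Icc (-ε) (1 + ε)
  eq_self : ∀ x ∈ Icc (0 : ℝ) 1, C x = x

theorem IsCutoff.continuous {ε : ℝ} {C : ℝ → ℝ} (h : IsCutoff ε C) : Continuous C :=
  (LipschitzWith.of_dist_le_mul (K := 1) fun x y => by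
    simpa [Real.dist_eq] using h.contraction x y).continuous

/-- A quadratic form on `L⁰(m)` is Markovian if for each `ε > 0` there is an `ε`-cutoff `C` such
that `E (C ∘ f) ≤ E f` for all `f`. -/
def IsMarkovian (m : Measure X) (E : QuadForm (X →ₘ[m] ℝ)) : Prop :=
  ∀ ε : ℝ, 0 < ε → ∃ (C : ℝ → ℝ) (hC : IsCutoff ε C),
    ∀ f : X →ₘ[m] ℝ, E (AEEqFun.comp C hC.continuous f) ≤ E f

/-- Energy forms: closed Markovian quadratic forms on `L⁰(m)`, where `m` is localizable. -/
structure IsEnergyForm (m : Measure X) (E : QuadForm (X →ₘ[m] ℝ)) : Prop where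
  localizable : IsLocalizable m
  markovian : IsMarkovian m E
  closed : E.IsClosed (localMeasureUniformSpace m)

/-- `E` is transient if its kernel is trivial. -/
def IsTransient (m : Measure X) (E : QuadForm (X →ₘ[m] ℝ)) : Prop := E.ker = {0}

/-- The embedding `(D(E), ‖·‖_E) → (L⁰(m), τ(m))`, `f ↦ f`, is continuous. -/
def EmbeddingContinuous (m : Measure X) (E : QuadForm (X →ₘ[m] ℝ)) : Prop :=
  @Continuous E.domain (X →ₘ[m] ℝ) E.seminormUniformSpace.toTopologicalSpace (tau m)
    (fun f => (f : X →ₘ[m] ℝ))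

end LZero

end EnergyForm

end

/-! The substance is that transience forces continuity. If continuity fails, some `U` of finite
measure carries functions `f k` with energy norm below `2⁻ᵏ` whose `d_U`-distance to `0` stays at
least `δ`. Clamping the tail sums of `|f k| ∧ 1` to `[0,1]` and letting their length grow gives
functions `h N` that dominate `|f N| ∧ 1`, decrease in `N`, and have energy norm at most `4 · 2⁻ᴺ`.
Their limit has zero energy, so it vanishes by transience, and dominated convergence on `U`
contradicts `δ > 0` (`exists_integral_lt`).

Two tools carry this. Lower semicontinuity along a.e. convergent sequences (`le_of_ae_tendsto`)
comes from closedness: almost minimizers of the form over shrinking midpoint convex sets around the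
limit are Cauchy by the parallelogram identity. It also lets `ε → 0` in the cutoffs, so the sharp
clamp to `[0,1]` does not increase energy (`unitClamp_le`).

Given continuity, the form topology is just the norm topology, so closedness is completeness of the
norm. Definiteness of an inner product returns transience. -/

open Filter Topology

namespace EnergyForm

/-! ### Closed forms and almost minimizing sequences. -/

namespace QuadForm

variable {V : Type*} [AddCommGroup V] [Module ℝ V]

theorem formSeminorm_apply (q : QuadForm V) (u : q.domain) :
    q.formSeminorm u = Real.sqrt (q.val u) := rfl

theorem formSeminorm_sq (q : QuadForm V) (u : q.domain) : q.formSeminorm u ^ 2 = q.val u :=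
  Real.sq_sqrt (q.val_nonneg u)

theorem ofReal_val (q : QuadForm V) (u : q.domain) : ENNReal.ofReal (q.val u) = q (u : V) :=
  ENNReal.ofReal_toReal (ne_of_lt u.2)

/-- A sequence in the domain of a closed form that is Cauchy for both the ambient uniformity and
the form seminorm has a common limit. -/
theorem IsClosed.exists_tendsto {𝓤 : UniformSpace V} {q : QuadForm V} (h : q.IsClosed 𝓤)
    {u : ℕ → q.domain} (hu : @CauchySeq V ℕ 𝓤 _ fun n => (u n : V))
    (hu' : ∀ ε > 0, ∃ N, ∀ k ≥ N, ∀ n ≥ N, q.formSeminorm (u k - u n) < ε) :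
    ∃ v : q.domain, Tendsto (fun n => (u n : V)) atTop (@nhds V 𝓤.toTopologicalSpace v) ∧
      Tendsto (fun n => q.formSeminorm (u n - v)) atTop (𝓝 0) := by
  have h1 : @CauchySeq q.domain ℕ q.seminormUniformSpace _ u := by
    let := q.formSeminorm.toSeminormedAddCommGroup
    refine Metric.cauchySeq_iff.2 fun ε hε => ?_
    obtain ⟨N, hN⟩ := hu' ε hε
    refine ⟨N, fun k hk n hn => ?_⟩
    rw [dist_eq_norm]
    exact hN k hk n hn
  have h2 : @CauchySeq q.domain ℕ (q.formUniformSpace 𝓤) _ u := by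
    refine cauchy_inf_uniformSpace.2 ⟨?_, h1⟩
    refine (cauchy_comap_uniformSpace (u := 𝓤) (f := (Subtype.val : q.domain → V))).2 ?_
    rw [Filter.map_map]
    exact hu
  obtain ⟨v, hv⟩ := @cauchySeq_tendsto_of_complete _ _ (q.formUniformSpace 𝓤) _ h _ h2
  refine ⟨v, ?_, ?_⟩
  · have hc : @Continuous _ _ (q.formUniformSpace 𝓤).toTopologicalSpace 𝓤.toTopologicalSpace
        (Subtype.val : q.domain → V) := by
      refine @UniformContinuous.continuous _ _ (q.formUniformSpace 𝓤) 𝓤 _ ?_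
      exact uniformContinuous_iff_le_comap.2 inf_le_left
    exact (@Continuous.tendsto _ _ (_) (_) _ hc v).comp hv
  · have hc : @Continuous _ _ (q.formUniformSpace 𝓤).toTopologicalSpace
        q.seminormUniformSpace.toTopologicalSpace id := by
      refine @UniformContinuous.continuous _ _ (q.formUniformSpace 𝓤) q.seminormUniformSpace _ ?_
      refine uniformContinuous_iff_le_comap.2 ?_
      rw [uniformSpace_comap_id]
      exact inf_le_right
    have h3 := (@Continuous.tendsto _ _ (_) (_) _ hc v).comp hv
    let := q.formSeminorm.toSeminormedAddCommGroup
    have h4 := tendsto_iff_norm_sub_tendsto_zero.1 h3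
    exact h4

theorem tendsto_val (q : QuadForm V) {u : ℕ → q.domain} {v : q.domain}
    (h : Tendsto (fun n => q.formSeminorm (u n - v)) atTop (𝓝 0)) :
    Tendsto (fun n => q.val (u n)) atTop (𝓝 (q.val v)) := by
  let := q.formSeminorm.toSeminormedAddCommGroup
  have h1 : Tendsto u atTop (𝓝 v) := tendsto_iff_norm_sub_tendsto_zero.2 h
  have h2 : Tendsto (fun n => q.formSeminorm (u n) ^ 2) atTop (𝓝 (q.formSeminorm v ^ 2)) :=
    h1.norm.pow 2
  simpa only [formSeminorm_sq] using h2

/-- Almost minimizing sequences in a decreasing sequence of midpoint convex sets. -/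
theorem exists_cauchy_of_antitone (q : QuadForm V) {K : ℕ → Set q.domain} (hK : Antitone K)
    (hmid : ∀ n, ∀ u ∈ K n, ∀ v ∈ K n, (1 / 2 : ℝ) • (u + v) ∈ K n) {C : ℝ}
    (hC : ∀ n, ∃ u ∈ K n, q.val u ≤ C) :
    ∃ g : ℕ → q.domain, (∀ n, g n ∈ K n) ∧ (∀ n, q.val (g n) ≤ C + 1 / ((n : ℝ) + 1)) ∧
      ∀ ε > 0, ∃ N, ∀ k ≥ N, ∀ n ≥ N, q.formSeminorm (g k - g n) < ε := by
  let a : ℕ → ℝ := fun n => sInf (q.val '' K n)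
  have hbdd : ∀ n, BddBelow (q.val '' K n) := fun n =>
    ⟨0, by rintro _ ⟨u, -, rfl⟩; exact q.val_nonneg u⟩
  have ha : ∀ n, ∀ u ∈ K n, a n ≤ q.val u := fun n u hu => csInf_le (hbdd n) ⟨u, hu, rfl⟩
  have haC : ∀ n, a n ≤ C := fun n => by
    obtain ⟨u, hu, h⟩ := hC n
    exact (ha n u hu).trans h
  have hne : ∀ n, (q.val '' K n).Nonempty := fun n => by
    obtain ⟨u, hu, -⟩ := hC n
    exact ⟨_, u, hu, rfl⟩
  have hmono : Monotone a := fun k n hkn =>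
    csInf_le_csInf (hbdd k) (hne n) (image_mono (hK hkn))
  have hex : ∀ n : ℕ, ∃ u ∈ K n, q.val u < a n + 1 / ((n : ℝ) + 1) := fun n => by
    obtain ⟨_, ⟨u, hu, rfl⟩, h⟩ := exists_lt_of_csInf_lt (hne n)
      (lt_add_of_pos_right (a n) (Nat.one_div_pos_of_nat (α := ℝ) (n := n)))
    exact ⟨u, hu, h⟩
  choose g hg hg' using hex
  refine ⟨g, hg, fun n => (hg' n).le.trans (by linarith [haC n]), fun ε hε => ?_⟩
  -- The midpoint of `g k` and `g n` lies in `K k`, so its value is at least `a k`; the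
  -- parallelogram identity turns this into a bound on the difference.
  have hbound : ∀ k n, k ≤ n → q.val (g k - g n) ≤
      2 * (a n - a k) + 4 * (1 / ((k : ℝ) + 1)) := fun k n hkn => by
    have h1 := q.val_parallelogram (g k) (g n)
    have h2 := ha k _ (hmid k _ (hg k) _ (hK hkn (hg n)))
    rw [q.val_smul] at h2
    have h3 := hg' k
    have h4 := hg' n
    have h5 : 1 / ((n : ℝ) + 1) ≤ 1 / ((k : ℝ) + 1) := Nat.one_div_le_one_div hkn
    linarith
  have hlim : Tendsto a atTop (𝓝 (⨆ n, a n)) :=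
    tendsto_atTop_ciSup hmono ⟨C, by rintro _ ⟨n, rfl⟩; exact haC n⟩
  have hle : ∀ n, a n ≤ ⨆ n, a n := fun n =>
    le_ciSup (f := a) ⟨C, by rintro _ ⟨n, rfl⟩; exact haC n⟩ n
  have h0 : Tendsto (fun k : ℕ => 2 * ((⨆ n, a n) - a k) + 4 * (1 / ((k : ℝ) + 1))) atTop
      (𝓝 0) := by
    have := ((hlim.const_sub (⨆ n, a n)).const_mul 2).add
      ((tendsto_one_div_add_atTop_nhds_zero_nat (𝕜 := ℝ)).const_mul 4)
    simpa using this
  obtain ⟨N, hN⟩ := (h0.eventually_lt_const (show (0 : ℝ) < ε ^ 2 by positivity)).exists_forall_of_atTop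
  have key : ∀ k ≥ N, ∀ n, k ≤ n → q.formSeminorm (g k - g n) < ε := fun k hk n hkn => by
    rw [formSeminorm_apply, Real.sqrt_lt' hε]
    linarith [hbound k n hkn, hN k hk, hle n]
  refine ⟨N, fun k hk n hn => ?_⟩
  rcases le_total k n with h | h
  · exact key k hk n h
  · rw [map_sub_rev]
    exact key n hn k h

end QuadForm

/-! ### Lower semicontinuity with respect to a.e. convergence. -/

section LZero

variable {X : Type*} [MeasurableSpace X] {m : Measure X}

theorem tendsto_dist_of_ae_tendsto {f : ℕ → X →ₘ[m] ℝ} {g : X →ₘ[m] ℝ}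
    (h : ∀ᵐ x ∂m, Tendsto (fun n => f n x) atTop (𝓝 (g x))) (U : FinSets m) :
    Tendsto (fun n => ∫ x in U.1, min |f n x - g x| 1 ∂m) atTop (𝓝 0) := by
  have : IsFiniteMeasure (m.restrict U.1) := ⟨by simpa using U.2.2⟩
  have h0 : (∫ _ in U.1, (0 : ℝ) ∂m) = 0 := by simp
  rw [← h0]
  refine tendsto_integral_of_dominated_convergence (fun _ => 1)
    (fun n => (integrable_dist m U (f n) g).aestronglyMeasurable) (integrable_const 1)
    (fun n => Eventually.of_forall fun x => ?_) ?_
  · rw [Real.norm_eq_abs, abs_of_nonneg (le_min (abs_nonneg _) zero_le_one)]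
    exact min_le_right _ _
  · filter_upwards [ae_restrict_of_ae h] with x hx
    have := ((hx.sub_const (g x)).abs).min (tendsto_const_nhds (x := (1 : ℝ)))
    simpa using this

theorem tendsto_tau_iff {f : ℕ → X →ₘ[m] ℝ} {g : X →ₘ[m] ℝ} :
    Tendsto f atTop (@nhds _ (tau m) g) ↔
      ∀ U : FinSets m, Tendsto (fun n => ∫ x in U.1, min |f n x - g x| 1 ∂m) atTop (𝓝 0) := by
  have h : tau m = ⨅ U : FinSets m, (pseudoMetric m U).toUniformSpace.toTopologicalSpace :=
    UniformSpace.toTopologicalSpace_iInf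
  rw [h, nhds_iInf, tendsto_iInf]
  refine forall_congr' fun U => ?_
  let := pseudoMetric m U
  exact tendsto_iff_dist_tendsto_zero

theorem tendsto_tau_of_ae_tendsto {f : ℕ → X →ₘ[m] ℝ} {g : X →ₘ[m] ℝ}
    (h : ∀ᵐ x ∂m, Tendsto (fun n => f n x) atTop (𝓝 (g x))) :
    Tendsto f atTop (@nhds _ (tau m) g) :=
  tendsto_tau_iff.2 (tendsto_dist_of_ae_tendsto h)

/-- Local convergence in measure is separated if the measure is semi-finite. -/
theorem IsLocalizable.eq_of_dist_eq_zero (hm : IsLocalizable m) {f g : X →ₘ[m] ℝ}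
    (h : ∀ U : FinSets m, ∫ x in U.1, min |f x - g x| 1 ∂m = 0) : f = g := by
  have hA : MeasurableSet {x | f x = g x}ᶜ :=
    (measurableSet_eq_fun f.measurable g.measurable).compl
  have key : ∀ A ⊆ {x | f x = g x}ᶜ, MeasurableSet A → m A < ∞ → m A = 0 := by
    intro A hAs hAm hAf
    have h1 := (integral_eq_zero_iff_of_nonneg
      (fun x => le_min (abs_nonneg _) zero_le_one)
      (integrable_dist m ⟨A, hAm, hAf⟩ f g)).1 (h ⟨A, hAm, hAf⟩)
    have h2 : ∀ᵐ x ∂m, x ∈ A → min |f x - g x| 1 = 0 := (ae_restrict_iff' hAm).1 h1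
    refine measure_mono_null (t := {x | x ∈ A → min |f x - g x| 1 = 0}ᶜ)
      (fun x hx hx' => ?_) (mem_ae_iff.1 h2)
    have h3 : 0 < |f x - g x| := abs_pos.2 (sub_ne_zero.2 (hAs hx))
    exact (lt_min h3 one_pos).ne' (hx' hx)
  refine AEEqFun.ext (mem_ae_iff.2 ?_)
  by_cases hfin : m {x | f x = g x}ᶜ < ∞
  · exact key _ subset_rfl hA hfin
  · obtain ⟨A, hAs, hAm, hpos, hlt⟩ := hm.semifinite _ hA (not_lt_top_iff.1 hfin)
    exact absurd (key A hAs hAm hlt) hpos.ne'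

/-- The functions whose distance to `g` is almost everywhere at most that of the tail
`f n, f (n + 1), …`. -/
def tailHull (f : ℕ → X →ₘ[m] ℝ) (g : X →ₘ[m] ℝ) (n : ℕ) : Set (X →ₘ[m] ℝ) :=
  {u | ∀ᵐ x ∂m, ∀ ε : ℝ, (∀ k ≥ n, |f k x - g x| ≤ ε) → |u x - g x| ≤ ε}

theorem mem_tailHull (f : ℕ → X →ₘ[m] ℝ) (g : X →ₘ[m] ℝ) (n : ℕ) : f n ∈ tailHull f g n :=
  ae_of_all m fun _ _ h => h n le_rfl

theorem tailHull_antitone (f : ℕ → X →ₘ[m] ℝ) (g : X →ₘ[m] ℝ) : Antitone (tailHull f g) :=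
by
  intro k n hkn u hu
  change ∀ᵐ x ∂m, ∀ ε : ℝ, (∀ i ≥ k, |f i x - g x| ≤ ε) → |u x - g x| ≤ ε
  filter_upwards [hu] with x hx ε h using hx ε fun i hi => h i (hkn.trans hi)

/-- Intervals centred at `g x` are convex. This closure is what permits minimizing energy over the
hulls. -/
theorem midpoint_mem_tailHull {f : ℕ → X →ₘ[m] ℝ} {g : X →ₘ[m] ℝ} {n : ℕ} {u v : X →ₘ[m] ℝ}
    (hu : u ∈ tailHull f g n) (hv : v ∈ tailHull f g n) :
    (1 / 2 : ℝ) • (u + v) ∈ tailHull f g n := by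
  filter_upwards [hu, hv, AEEqFun.coeFn_smul (1 / 2 : ℝ) (u + v), AEEqFun.coeFn_add u v]
    with x h1 h2 h3 h4 ε hε
  rw [h3, Pi.smul_apply, h4, Pi.add_apply, smul_eq_mul]
  have h5 := abs_le.1 (h1 ε hε)
  have h6 := abs_le.1 (h2 ε hε)
  rw [abs_le]
  constructor <;> linarith

/-- The hulls shrink to `g` pointwise, so replacing `f n` by an almost minimizer keeps the limit. -/
theorem ae_tendsto_of_mem_tailHull {f : ℕ → X →ₘ[m] ℝ} {g : X →ₘ[m] ℝ}
    (h : ∀ᵐ x ∂m, Tendsto (fun n => f n x) atTop (𝓝 (g x))) {u : ℕ → X →ₘ[m] ℝ}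
    (hu : ∀ n, u n ∈ tailHull f g n) :
    ∀ᵐ x ∂m, Tendsto (fun n => u n x) atTop (𝓝 (g x)) := by
  filter_upwards [h, ae_all_iff.2 hu] with x hx hux
  refine Metric.tendsto_atTop.2 fun ε hε => ?_
  obtain ⟨N, hN⟩ := Metric.tendsto_atTop.1 hx (ε / 2) (half_pos hε)
  refine ⟨N, fun n hn => ?_⟩
  rw [Real.dist_eq]
  have := hux n (ε / 2) fun k hk => (hN k (hn.trans hk)).le
  linarith

/-- Closed forms on `L⁰(m)` are lower semicontinuous along almost everywhere convergent
sequences. -/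
theorem le_of_ae_tendsto (hm : IsLocalizable m) {E : QuadForm (X →ₘ[m] ℝ)}
    (hE : E.IsClosed (localMeasureUniformSpace m)) {f : ℕ → X →ₘ[m] ℝ} {g : X →ₘ[m] ℝ}
    (h : ∀ᵐ x ∂m, Tendsto (fun n => f n x) atTop (𝓝 (g x))) {C : ℝ≥0∞}
    (hC : ∀ n, E (f n) ≤ C) : E g ≤ C := by
  rcases eq_or_ne C ∞ with rfl | hCtop
  · exact le_top
  have hval : ∀ u : E.domain, E (u : X →ₘ[m] ℝ) ≤ C ↔ E.val u ≤ C.toReal := fun u =>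
    (ENNReal.toReal_le_toReal (ne_of_lt u.2) hCtop).symm
  let K : ℕ → Set E.domain := fun n => Subtype.val ⁻¹' tailHull f g n
  obtain ⟨u, huK, huC, hcau⟩ := E.exists_cauchy_of_antitone (K := K) (C := C.toReal)
    (fun _ _ hkn => preimage_mono (tailHull_antitone f g hkn))
    (fun n _ hu _ hv => midpoint_mem_tailHull hu hv)
    (fun n => ⟨⟨f n, (hC n).trans_lt hCtop.lt_top⟩, mem_tailHull f g n, (hval _).1 (hC n)⟩)
  have hae := ae_tendsto_of_mem_tailHull h huK
  obtain ⟨v, hv, hv'⟩ := hE.exists_tendsto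
    (@Tendsto.cauchySeq _ _ (localMeasureUniformSpace m) _ _ _ _ (tendsto_tau_of_ae_tendsto hae)) hcau
  -- The limit given by closedness is the a.e. limit, since semi-finiteness makes `τ(m)` separated.
  have hgv : g = v := by
    refine hm.eq_of_dist_eq_zero fun U => ?_
    let := pseudoMetric m U
    have h1 : Tendsto (fun n => (u n : X →ₘ[m] ℝ)) atTop (𝓝 g) :=
      tendsto_iff_dist_tendsto_zero.2 (tendsto_dist_of_ae_tendsto hae U)
    have h2 : Tendsto (fun n => (u n : X →ₘ[m] ℝ)) atTop (𝓝 (v : X →ₘ[m] ℝ)) :=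
      tendsto_iff_dist_tendsto_zero.2 (tendsto_tau_iff.1 hv U)
    exact Metric.inseparable_iff.1 (tendsto_nhds_unique_inseparable h1 h2)
  rw [hgv, hval]
  refine le_of_tendsto_of_tendsto' (E.tendsto_val hv') ?_ huC
  simpa using (tendsto_one_div_add_atTop_nhds_zero_nat (𝕜 := ℝ)).const_add C.toReal

end LZero

/-! ### The unit contraction and truncated absolute values. -/

namespace QuadForm

variable {V : Type*} [AddCommGroup V] [Module ℝ V]

theorem formSeminorm_le_iff (q : QuadForm V) (u : q.domain) {r : ℝ} (hr : 0 ≤ r) :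
    q.formSeminorm u ≤ r ↔ q (u : V) ≤ ENNReal.ofReal (r ^ 2) := by
  rw [← q.ofReal_val, ENNReal.ofReal_le_ofReal_iff (sq_nonneg r), ← q.formSeminorm_sq,
    sq_le_sq₀ (apply_nonneg _ _) hr]

theorem formSeminorm_sum_le (q : QuadForm V) {ι : Type*} (s : Finset ι) (u : ι → q.domain) :
    q.formSeminorm (∑ i ∈ s, u i) ≤ ∑ i ∈ s, q.formSeminorm (u i) := by
  let := q.formSeminorm.toSeminormedAddCommGroup
  exact norm_sum_le s u

end QuadForm

/-- The projection of the real line onto the unit interval. -/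
def unitClamp (t : ℝ) : ℝ := max 0 (min t 1)

theorem continuous_unitClamp : Continuous unitClamp := by
  unfold unitClamp; fun_prop

theorem monotone_unitClamp : Monotone unitClamp := fun _ _ h =>
  max_le_max le_rfl (min_le_min h le_rfl)

theorem unitClamp_nonneg (t : ℝ) : 0 ≤ unitClamp t := le_max_left _ _

theorem unitClamp_le_one (t : ℝ) : unitClamp t ≤ 1 := max_le zero_le_one (min_le_right _ _)

theorem unitClamp_of_mem {t : ℝ} (h0 : 0 ≤ t) (h1 : t ≤ 1) : unitClamp t = t := by
  rw [unitClamp, min_eq_left h1, max_eq_right h0]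

theorem unitClamp_add_neg (t : ℝ) : unitClamp t + unitClamp (-t) = min |t| 1 := by
  unfold unitClamp
  rcases le_total 0 t with h | h
  · rw [abs_of_nonneg h, max_eq_right (le_min h zero_le_one),
      max_eq_left ((min_le_left _ _).trans (neg_nonpos.2 h)), add_zero]
  · rw [abs_of_nonpos h, max_eq_right (le_min (neg_nonneg.2 h) zero_le_one),
      max_eq_left ((min_le_left _ _).trans h), zero_add]

/-- Monotonicity confines `C` to `[-ε, 0]` left of `0` and to `[1, 1 + ε]` right of `1`. Hence
cutoffs converge to the clamp as `ε → 0`. -/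
theorem IsCutoff.abs_sub_unitClamp_le {ε : ℝ} {C : ℝ → ℝ} (h : IsCutoff ε C) (t : ℝ) :
    |C t - unitClamp t| ≤ ε := by
  have hm := h.mapsTo t
  have hε : 0 ≤ ε := by
    have := (h.mapsTo 0).1
    rw [h.map_zero] at this
    linarith
  rcases le_total t 0 with h0 | h0
  · have h1 := h.monotone h0
    rw [h.map_zero] at h1
    rw [unitClamp, max_eq_left ((min_le_left _ _).trans h0), abs_le]
    constructor <;> linarith [hm.1]
  rcases le_total t 1 with h1 | h1
  · rw [h.eq_self t ⟨h0, h1⟩, unitClamp_of_mem h0 h1, sub_self, abs_zero]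
    exact hε
  · have h2 := h.monotone h1
    rw [h.eq_self 1 ⟨zero_le_one, le_rfl⟩] at h2
    rw [unitClamp, min_eq_right h1, max_eq_right zero_le_one, abs_le]
    constructor <;> linarith [hm.2]

section LZero

variable {X : Type*} [MeasurableSpace X] {m : Measure X}

/-- The unit contraction operates on energy forms. -/
theorem IsEnergyForm.unitClamp_le {E : QuadForm (X →ₘ[m] ℝ)} (hE : IsEnergyForm m E)
    (f : X →ₘ[m] ℝ) : E (AEEqFun.comp unitClamp continuous_unitClamp f) ≤ E f := by
  choose C hC hCE using fun n : ℕ => hE.markovian (1 / ((n : ℝ) + 1)) Nat.one_div_pos_of_nat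
  refine le_of_ae_tendsto hE.localizable hE.closed ?_ fun n => hCE n f
  filter_upwards [AEEqFun.coeFn_comp unitClamp continuous_unitClamp f,
    ae_all_iff.2 fun n => AEEqFun.coeFn_comp (C n) (hC n).continuous f] with x hx hxC
  simp only [hx, hxC, Function.comp_apply]
  refine tendsto_iff_dist_tendsto_zero.2 (squeeze_zero (fun _ => dist_nonneg) (fun n => ?_)
    (tendsto_one_div_add_atTop_nhds_zero_nat (𝕜 := ℝ)))
  rw [Real.dist_eq]
  exact (hC n).abs_sub_unitClamp_le _

/-- Since `|t| ∧ 1` is the clamp of `t` plus the clamp of `-t`, the triangle inequality suffices and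
costs the factor `2`. -/
theorem IsEnergyForm.exists_min_abs_one {E : QuadForm (X →ₘ[m] ℝ)} (hE : IsEnergyForm m E)
    (f : E.domain) : ∃ u : E.domain, (∀ᵐ x ∂m, (u : X →ₘ[m] ℝ) x = min |(f : X →ₘ[m] ℝ) x| 1) ∧
      E.formSeminorm u ≤ 2 * E.formSeminorm f := by
  have key : ∀ g : E.domain, ∃ v : E.domain,
      (v : X →ₘ[m] ℝ) = AEEqFun.comp unitClamp continuous_unitClamp g ∧
        E.formSeminorm v ≤ E.formSeminorm g := fun g =>
    ⟨⟨_, (hE.unitClamp_le g).trans_lt g.2⟩, rfl,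
      Real.sqrt_le_sqrt (ENNReal.toReal_mono (ne_of_lt g.2) (hE.unitClamp_le g))⟩
  obtain ⟨v, hv, hvn⟩ := key f
  obtain ⟨w, hw, hwn⟩ := key (-f)
  refine ⟨v + w, ?_, ?_⟩
  · rw [Submodule.coe_add, hv, hw, Submodule.coe_neg]
    filter_upwards [AEEqFun.coeFn_add (AEEqFun.comp unitClamp continuous_unitClamp f.1)
        (AEEqFun.comp unitClamp continuous_unitClamp (-f.1)),
      AEEqFun.coeFn_comp unitClamp continuous_unitClamp f.1,
      AEEqFun.coeFn_comp unitClamp continuous_unitClamp (-f.1),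
      AEEqFun.coeFn_neg f.1] with x h1 h2 h3 h4
    rw [h1, Pi.add_apply, h2, h3, Function.comp_apply, Function.comp_apply, h4, Pi.neg_apply,
      unitClamp_add_neg]
  · rw [map_neg_eq_map] at hwn
    linarith [map_add_le_add E.formSeminorm v w]

theorem coeFn_sum_ae {ι : Type*} (s : Finset ι) (f : ι → X →ₘ[m] ℝ) :
    ∀ᵐ x ∂m, (∑ i ∈ s, f i : X →ₘ[m] ℝ) x = ∑ i ∈ s, f i x := by
  classical
  induction s using Finset.induction_on with
  | empty =>
    filter_upwards [AEEqFun.coeFn_zero (μ := m) (α := X) (β := ℝ)] with x hx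
    rw [Finset.sum_empty, hx, Finset.sum_empty, Pi.zero_apply]
  | insert i s hi ih =>
    rw [Finset.sum_insert hi]
    filter_upwards [ih, AEEqFun.coeFn_add (f i) (∑ i ∈ s, f i)] with x h1 h2
    rw [h2, Pi.add_apply, h1, Finset.sum_insert hi]

/-! ### From transience to continuity of the embedding. -/

/-- For a transient form, small energy norm implies smallness in local measure. -/
theorem IsEnergyForm.exists_integral_lt {E : QuadForm (X →ₘ[m] ℝ)} (hE : IsEnergyForm m E)
    (ht : IsTransient m E) (U : FinSets m) {δ : ℝ} (hδ : 0 < δ) :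
    ∃ η > 0, ∀ f : E.domain, E.formSeminorm f < η →
      ∫ x in U.1, min |(f : X →ₘ[m] ℝ) x| 1 ∂m < δ := by
  by_contra! hcon
  have : IsFiniteMeasure (m.restrict U.1) := ⟨by simpa using U.2.2⟩
  choose f hf hfδ using fun k : ℕ => hcon ((1 / 2) ^ k) (by positivity)
  choose u hu hun using fun k => hE.exists_min_abs_one (f k)
  let v : ℕ → X → ℝ := fun k x => min |(f k : X →ₘ[m] ℝ) x| 1
  have hv0 : ∀ k x, 0 ≤ v k x := fun k x => le_min (abs_nonneg _) zero_le_one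
  have hv1 : ∀ k x, v k x ≤ 1 := fun k x => min_le_right _ _
  have hvm : ∀ k, Measurable (v k) := fun k =>
    (continuous_abs.measurable.comp (f k : X →ₘ[m] ℝ).measurable).min measurable_const
  -- Clamping keeps the supremum over `n` finite even where the series diverges, without raising the
  -- energy.
  let c : ℕ → ℕ → X → ℝ := fun N n x => unitClamp (∑ k ∈ Finset.range n, v (N + k) x)
  have hc0 : ∀ N n x, 0 ≤ c N n x := fun N n x => unitClamp_nonneg _
  have hc1 : ∀ N n x, c N n x ≤ 1 := fun N n x => unitClamp_le_one _
  have hcm : ∀ N n, Measurable (c N n) := fun N n =>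
    continuous_unitClamp.measurable.comp (Finset.measurable_fun_sum _ fun k _ => hvm _)
  have hcmono : ∀ N x, Monotone fun n => c N n x := fun N x =>
    monotone_unitClamp.comp (monotone_nat_of_le_succ fun n => by
      rw [Finset.sum_range_succ]
      exact le_add_of_nonneg_right (hv0 _ _))
  let h : ℕ → X → ℝ := fun N x => ⨆ n, c N n x
  have hcb : ∀ N x, BddAbove (range fun n => c N n x) := fun N x =>
    ⟨1, by rintro _ ⟨n, rfl⟩; exact hc1 N n x⟩
  have hch : ∀ N n x, c N n x ≤ h N x := fun N n x => le_ciSup (hcb N x) n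
  have hlim : ∀ N x, Tendsto (fun n => c N n x) atTop (𝓝 (h N x)) := fun N x =>
    tendsto_atTop_ciSup (hcmono N x) (hcb N x)
  have hhm : ∀ N, Measurable (h N) := fun N => Measurable.iSup (hcm N)
  have hh0 : ∀ N x, 0 ≤ h N x := fun N x => (hc0 N 0 x).trans (hch N 0 x)
  have hh1 : ∀ N x, h N x ≤ 1 := fun N x => ciSup_le fun n => hc1 N n x
  have hvh : ∀ N x, v N x ≤ h N x := fun N x => by
    refine le_trans (le_of_eq ?_) (hch N 1 x)
    change _ = unitClamp _
    rw [Finset.sum_range_one, add_zero, unitClamp_of_mem (hv0 N x) (hv1 N x)]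
  -- Prepending `v N` to a sum of `n` terms starting at `N + 1` gives one of `n + 1` terms starting
  -- at `N`.
  have hanti : ∀ x, Antitone fun N => h N x := fun x => antitone_nat_of_succ_le fun N => by
    refine ciSup_le fun n => le_trans (monotone_unitClamp ?_) (hch N (n + 1) x)
    rw [Finset.sum_range_succ']
    refine le_add_of_le_of_nonneg (Finset.sum_le_sum fun k _ => le_of_eq ?_) (hv0 _ _)
    rw [add_assoc, add_comm 1 k]
  let H : X → ℝ := fun x => ⨅ N, h N x
  have hHm : Measurable H := Measurable.iInf hhm
  have hlimH : ∀ x, Tendsto (fun N => h N x) atTop (𝓝 (H x)) := fun x =>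
    tendsto_atTop_ciInf (hanti x) ⟨0, by rintro _ ⟨N, rfl⟩; exact hh0 N x⟩
  have mkc : ∀ {F : X → ℝ} (hF : Measurable F), ∀ᵐ x ∂m,
      (AEEqFun.mk F hF.aestronglyMeasurable : X →ₘ[m] ℝ) x = F x := fun hF =>
    AEEqFun.coeFn_mk _ hF.aestronglyMeasurable
  have hEc : ∀ N n, E (AEEqFun.mk (c N n) (hcm N n).aestronglyMeasurable) ≤
      ENNReal.ofReal ((4 * (1 / 2) ^ N) ^ 2) := fun N n => by
    let S : E.domain := ∑ k ∈ Finset.range n, u (N + k)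
    -- One factor `2` comes from truncating `|f k|`, the other from the geometric series.
    have hS : E.formSeminorm S ≤ 4 * (1 / 2) ^ N := by
      refine (E.formSeminorm_sum_le _ _).trans ?_
      calc ∑ k ∈ Finset.range n, E.formSeminorm (u (N + k))
          ≤ ∑ k ∈ Finset.range n, 2 * (1 / 2 : ℝ) ^ N * (1 / 2) ^ k :=
            Finset.sum_le_sum fun k _ => by
              rw [mul_assoc, ← pow_add]
              linarith [hun (N + k), hf (N + k)]
        _ = 2 * (1 / 2 : ℝ) ^ N * ∑ k ∈ Finset.range n, (1 / 2 : ℝ) ^ k := by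
            rw [Finset.mul_sum]
        _ ≤ 2 * (1 / 2 : ℝ) ^ N * 2 :=
            mul_le_mul_of_nonneg_left (sum_geometric_two_le n) (by positivity)
        _ = 4 * (1 / 2) ^ N := by ring
    have hcS : AEEqFun.mk (c N n) (hcm N n).aestronglyMeasurable =
        AEEqFun.comp unitClamp continuous_unitClamp (S : X →ₘ[m] ℝ) := by
      refine AEEqFun.ext ?_
      filter_upwards [mkc (hcm N n), AEEqFun.coeFn_comp unitClamp continuous_unitClamp S.1,
        coeFn_sum_ae (Finset.range n) fun k => (u (N + k) : X →ₘ[m] ℝ),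
        ae_all_iff.2 hu] with x h1 h2 h3 h4
      have h5 : (S : X →ₘ[m] ℝ) = ∑ k ∈ Finset.range n, (u (N + k) : X →ₘ[m] ℝ) :=
        Submodule.coe_sum _ _ _
      rw [h1, h2, Function.comp_apply, h5, h3]
      exact congrArg unitClamp (Finset.sum_congr rfl fun k _ => (h4 _).symm)
    rw [hcS]
    exact (hE.unitClamp_le _).trans ((E.formSeminorm_le_iff S (by positivity)).1 hS)
  have hEh : ∀ N, E (AEEqFun.mk (h N) (hhm N).aestronglyMeasurable) ≤
      ENNReal.ofReal ((4 * (1 / 2) ^ N) ^ 2) := fun N => by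
    refine le_of_ae_tendsto hE.localizable hE.closed ?_ (hEc N)
    filter_upwards [mkc (hhm N), ae_all_iff.2 fun n => mkc (hcm N n)] with x h1 h2
    simp only [h1, h2]
    exact hlim N x
  have hEH : ∀ N, E (AEEqFun.mk H hHm.aestronglyMeasurable) ≤
      ENNReal.ofReal ((4 * (1 / 2) ^ N) ^ 2) := fun N => by
    -- The shift by `N` makes the bound at level `N` valid for every term of the sequence.
    refine le_of_ae_tendsto hE.localizable hE.closed
      (f := fun n => AEEqFun.mk (h (n + N)) (hhm (n + N)).aestronglyMeasurable) ?_ fun n => ?_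
    · filter_upwards [mkc hHm, ae_all_iff.2 fun n => mkc (hhm n)] with x h1 h2
      simp only [h1, h2]
      exact (tendsto_add_atTop_iff_nat N).2 (hlimH x)
    · refine (hEh _).trans (ENNReal.ofReal_le_ofReal ?_)
      have : (1 / 2 : ℝ) ^ (n + N) ≤ (1 / 2) ^ N :=
        pow_le_pow_of_le_one (by norm_num) (by norm_num) (Nat.le_add_left N n)
      gcongr
  have hlim0 : Tendsto (fun N : ℕ => ENNReal.ofReal ((4 * (1 / 2 : ℝ) ^ N) ^ 2)) atTop (𝓝 0) := by
    have h1 := ((tendsto_pow_atTop_nhds_zero_of_lt_one (r := (1 / 2 : ℝ)) (by norm_num)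
      (by norm_num)).const_mul 4).pow 2
    simpa using ENNReal.tendsto_ofReal h1
  have hker : AEEqFun.mk H hHm.aestronglyMeasurable ∈ E.ker :=
    le_antisymm (ge_of_tendsto' hlim0 hEH) bot_le
  rw [ht, mem_singleton_iff] at hker
  have hH0 : ∀ᵐ x ∂m, H x = 0 := by
    filter_upwards [mkc hHm, AEEqFun.coeFn_zero (μ := m) (α := X) (β := ℝ)] with x h1 h2
    rw [← h1, hker, h2, Pi.zero_apply]
  have hint : ∀ N, Integrable (h N) (m.restrict U.1) := fun N =>
    Integrable.of_bound (hhm N).aestronglyMeasurable 1 (Eventually.of_forall fun x => by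
      rw [Real.norm_eq_abs, abs_of_nonneg (hh0 N x)]; exact hh1 N x)
  have hconv : Tendsto (fun N => ∫ x in U.1, h N x ∂m) atTop (𝓝 (∫ x in U.1, H x ∂m)) :=
    tendsto_integral_of_dominated_convergence (fun _ => 1)
      (fun N => (hint N).aestronglyMeasurable) (integrable_const 1)
      (fun N => Eventually.of_forall fun x => by
        rw [Real.norm_eq_abs, abs_of_nonneg (hh0 N x)]; exact hh1 N x)
      (Eventually.of_forall hlimH)
  rw [integral_eq_zero_of_ae (ae_restrict_of_ae hH0)] at hconv
  -- `δ ≤ ∫_U v N ≤ ∫_U h N → 0`.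
  refine (ge_of_tendsto' hconv fun N => (hfδ N).trans ?_).not_gt hδ
  refine integral_mono (Integrable.of_bound (hvm N).aestronglyMeasurable 1
    (Eventually.of_forall fun x => ?_)) (hint N) (hvh N)
  rw [Real.norm_eq_abs, abs_of_nonneg (hv0 N x)]
  exact hv1 N x

theorem IsEnergyForm.embeddingContinuous {E : QuadForm (X →ₘ[m] ℝ)} (hE : IsEnergyForm m E)
    (ht : IsTransient m E) : EmbeddingContinuous m E := by
  have h : tau m = ⨅ U : FinSets m, (pseudoMetric m U).toUniformSpace.toTopologicalSpace :=
    UniformSpace.toTopologicalSpace_iInf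
  rw [EmbeddingContinuous, h, continuous_iInf_rng]
  intro U
  let := E.formSeminorm.toSeminormedAddCommGroup
  refine (@Metric.continuous_iff _ _ E.formSeminorm.toSeminormedAddCommGroup.toPseudoMetricSpace
    (pseudoMetric m U) _).2 fun g ε hε => ?_
  obtain ⟨η, hη, hηf⟩ := hE.exists_integral_lt ht U hε
  refine ⟨η, hη, fun f hf => ?_⟩
  rw [dist_eq_norm] at hf
  have h1 := hηf (f - g) hf
  have h2 : ∫ x in U.1, min |((f - g : E.domain) : X →ₘ[m] ℝ) x| 1 ∂m =
      ∫ x in U.1, min |(f : X →ₘ[m] ℝ) x - (g : X →ₘ[m] ℝ) x| 1 ∂m := by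
    refine integral_congr_ae (ae_restrict_of_ae ?_)
    filter_upwards [AEEqFun.coeFn_sub f.1 g.1] with x hx
    rw [Submodule.coe_sub, hx, Pi.sub_apply]
  rw [h2] at h1
  exact h1

/-! ### Continuity, completeness and definiteness. -/

/-- For `f` in the kernel, the constant sequence `f` tends to `0` in the seminorm, hence in `τ(m)`,
which is separated. This supplies the definiteness needed for `isHilbert`. -/
theorem EmbeddingContinuous.isTransient {E : QuadForm (X →ₘ[m] ℝ)} (hm : IsLocalizable m)
    (h : EmbeddingContinuous m E) : IsTransient m E := by
  refine Subset.antisymm (fun f hf => ?_) (singleton_subset_iff.2 E.map_zero)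
  have hfE : E f = 0 := hf
  let g : E.domain := ⟨f, by change E f < ∞; rw [hfE]; exact ENNReal.zero_lt_top⟩
  have h1 : Tendsto (fun _ : ℕ => g) atTop
      (@nhds _ E.seminormUniformSpace.toTopologicalSpace 0) := by
    let := E.formSeminorm.toSeminormedAddCommGroup
    refine tendsto_iff_norm_sub_tendsto_zero.2 ?_
    have h2 : ‖g - 0‖ = 0 := by
      rw [sub_zero]
      change Real.sqrt (E f).toReal = 0
      simp [hfE]
    exact tendsto_const_nhds.congr fun _ => h2.symm
  have h2 := (@Continuous.tendsto _ _ (_) (_) _ h 0).comp h1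
  refine hm.eq_of_dist_eq_zero fun U => ?_
  exact tendsto_nhds_unique tendsto_const_nhds (tendsto_tau_iff.1 h2 U)

theorem EmbeddingContinuous.isHilbert {E : QuadForm (X →ₘ[m] ℝ)} (hE : IsEnergyForm m E)
    (h : EmbeddingContinuous m E) : E.IsHilbert := by
  let c : InnerProductSpace.Core ℝ E.domain :=
    { E.preInner with
      definite := fun f hf => by
        have h1 : E.val f = 0 := (E.polar_self f).symm.trans hf
        have h2 : E (f : X →ₘ[m] ℝ) = 0 := by rw [← E.ofReal_val, h1, ENNReal.ofReal_zero]
        have h3 : (f : X →ₘ[m] ℝ) ∈ E.ker := h2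
        rw [h.isTransient hE.localizable] at h3
        exact Subtype.ext h3 }
  refine ⟨c, fun _ _ => rfl, ?_⟩
  -- The inner product norm and the form seminorm are built separately; they agree because the
  -- polarization restores the form on the diagonal.
  have h1 : (InnerProductSpace.Core.toNormedAddCommGroup (cd := c)).toUniformSpace =
      E.seminormUniformSpace := by
    refine congrArg (fun d : PseudoMetricSpace E.domain => d.toUniformSpace) (PseudoMetricSpace.ext ?_)
    ext u v
    refine (@dist_eq_norm _ (InnerProductSpace.Core.toNormedAddCommGroup
      (cd := c)).toSeminormedAddCommGroup u v).trans
      (Eq.trans ?_ (@dist_eq_norm _ E.formSeminorm.toSeminormedAddCommGroup u v).symm)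
    change Real.sqrt (E.polar (u - v) (u - v)) = Real.sqrt (E.val (u - v))
    rw [E.polar_self]
  -- A continuous homomorphism of uniform groups is uniformly continuous, so the trace of `τ(m)`
  -- adds nothing to the seminorm uniformity.
  have h2 : E.formUniformSpace (localMeasureUniformSpace m) = E.seminormUniformSpace := by
    refine inf_eq_right.2 (uniformContinuous_iff_le_comap.1 ?_)
    have h3 : @IsUniformAddGroup E.domain E.seminormUniformSpace _ := by
      let := E.formSeminorm.toSeminormedAddCommGroup
      infer_instance
    have h4 := isUniformAddGroup_localMeasure m
    let := E.seminormUniformSpace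
    let := localMeasureUniformSpace m
    exact uniformContinuous_addMonoidHom_of_continuous (f := E.domain.subtype) h
  have h3 := hE.closed
  rw [QuadForm.IsClosed, h2] at h3
  rw [h1]
  exact h3

theorem isTransient_of_isHilbert {E : QuadForm (X →ₘ[m] ℝ)} (h : E.IsHilbert) :
    IsTransient m E := by
  obtain ⟨c, hc, -⟩ := h
  refine Subset.antisymm (fun f hf => ?_) (singleton_subset_iff.2 E.map_zero)
  have hfE : E f = 0 := hf
  let g : E.domain := ⟨f, by change E f < ∞; rw [hfE]; exact ENNReal.zero_lt_top⟩
  have h1 : g = 0 := c.definite g (by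
    rw [hc, E.polar_self]
    change (E f).toReal = 0
    rw [hfE, ENNReal.toReal_zero])
  exact congrArg Subtype.val h1

end LZero

end EnergyForm

theorem mainTheorem10 {X : Type*} [MeasurableSpace X] (m : MeasureTheory.Measure X)
    (E : EnergyForm.QuadForm (X →ₘ[m] ℝ)) (hE : EnergyForm.IsEnergyForm m E) :
    List.TFAE
      [EnergyForm.IsTransient m E,
       EnergyForm.EmbeddingContinuous m E,
       E.IsHilbert] := by
  tfae_have 1 → 2 := hE.embeddingContinuous
  tfae_have 2 → 3 := fun h => h.isHilbert hE
  tfae_have 3 → 1 := EnergyForm.isTransient_of_isHilbert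
  tfae_finish
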